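/- For $n\ge 0$ let $B_n$ be the hyperoctahedral group of permutations $\pi$ of $\{-n,\dots,-1,1,\dots,n\}$ with $\pi(-j)=-\pi(j)$ for all $j$. Let $w=w_1\cdots w_n$ be a word of nonzero integers with distinct absolute values $\sigma_p=|w_p|$. Its number of inversions of type $B$ is $\mathrm{inv}_B(w)=\sum_{p=1}^n e_p$, where $$e_p=\begin{cases}|\{q<p:\sigma_q>\sigma_p\}| & \text{if } w_p>0,\\ 1+2\,|\{q<p:\sigma_q<\sigma_p\}|+|\{q<p:\sigma_q>\sigma_p\}| & \text{if } w_p<0.\end{cases}$$ For $\pi\in B_n$ put $\mathrm{inv}_B(\pi)=\mathrm{inv}_B(\pi(1)\cdots\pi(n))$. For $k\in\mathbb Z$ let $I_B(n,k)=\{\pi\in B_n:\mathrm{inv}_B(\pi)=k\}$ (empty for $k<0$) and $i_B(n,k)=|I_B(n,k)|$. Let $\mathcal C_B(n)$ be the set of those $\pi\in I_B(n,n-1)$ such that, for every $1\le k\le n$, the prefix $\pi(1)\cdots\pi(k)$ has fewer than $k$ inversions of type $B$. Let $C_m=\frac1{m+1}\binom{2m}{m}$, let $C(x)=\sum_{m\ge0}C_mx^m$,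 and for $j\ge 0$ let $T_j(x)=\sum_{n\ge0}i_B(n,n-j)\,x^n$. **Theorem.** $\mathcal C_B(0)=\emptyset$, and $|\mathcal C_B(m)|=C_{m-1}$ for every $m\ge1$. For every $j\ge1$ and every $n\ge0$ there is a bijection $$I_B(n,n-j-1)\;\cong\;\bigsqcup_{i=0}^{n} I_B(i,i-j)\times\mathcal C_B(n-i).$$ Consequently, for every $j\ge1$, the formal power series $T_j(x)$ satisfy $$T_{j+1}(x)=x\,C(x)\,T_j(x)\qquad\text{and}\qquad T_j(x)=\bigl(x\,C(x)\bigr)^j\,T_0(x).$$ -/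

import Mathlib

open scoped PowerSeries

namespace MahonianB

/-- The set `⟨n⟩ = {-n, …, -1, 1, …, n}`. -/
abbrev SignedIndex (n : ℕ) : Type := {z : ℤ // z ≠ 0 ∧ |z| ≤ (n : ℤ)}

/-- Negation `j ↦ -j` on `⟨n⟩`. -/
instance (n : ℕ) : Neg (SignedIndex n) :=
  ⟨fun z => ⟨-z.1, neg_ne_zero.mpr z.2.1, by rw [abs_neg]; exact z.2.2⟩⟩

/-- The hyperoctahedral group `B_n`: the permutations `π` of `⟨n⟩` with `π(-j) = -π(j)`. -/
def B (n : ℕ) : Subgroup (Equiv.Perm (SignedIndex n)) where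
  carrier := {π | ∀ j, π (-j) = -π j}
  mul_mem' := by
    intro a b ha hb j
    simp only [Equiv.Perm.mul_apply]
    rw [hb j, ha (b j)]
  one_mem' := fun _ => rfl
  inv_mem' := by
    intro a ha j
    apply a.injective
    rw [ha (a⁻¹ j)]
    simp

/-- The one-line notation `π(1) π(2) ⋯ π(n)` of a signed permutation, as a word of integers.
Positions are counted from `0`, so the letter in position `p` is `π(p + 1)`. -/
def oneLine {n : ℕ} (π : B n) (p : Fin n) : ℤ :=
  (π.1 ⟨(p : ℤ) + 1, by omega, by rw [abs_of_nonneg (by omega)]; omega⟩).1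

/-- The contribution of position `p` to the number of inversions of type `B` of a signed word `w`.
Writing `σ_q = |w_q|`, it is `#{q < p : σ_q > σ_p}` if `w_p > 0`, and
`1 + 2 #{q < p : σ_q < σ_p} + #{q < p : σ_q > σ_p}` if `w_p < 0`.
For the one-line notation of `π ∈ B_n` the number `inv_i(π)` is the contribution
of the `(n + 1 - i)`-th letter. -/
def invAt {n : ℕ} (w : Fin n → ℤ) (p : Fin n) : ℕ :=
  if 0 < w p then
    (Finset.univ.filter fun q : Fin n => q < p ∧ |w p| < |w q|).card
  else
    1 + 2 * (Finset.univ.filter fun q : Fin n => q < p ∧ |w q| < |w p|).card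
      + (Finset.univ.filter fun q : Fin n => q < p ∧ |w p| < |w q|).card

/-- The number of inversions of type `B` of a signed word. -/
def invWord {n : ℕ} (w : Fin n → ℤ) : ℕ := ∑ p, invAt w p

/-- The number `inv_B(π)` of inversions of type `B` of a signed permutation. -/
def invB {n : ℕ} (π : B n) : ℕ := invWord (oneLine π)

/-- The prefix `π(1) ⋯ π(k)` of length `k` of (the one-line notation of) `π`. -/
def pre {n : ℕ} (π : B n) (k : ℕ) (hk : k ≤ n) : Fin k → ℤ :=
  fun p => oneLine π (Fin.castLE hk p)

/-- `I_B(n, k)`: the elements of `B_n` with exactly `k` inversions of type `B`. The number `k` is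
an integer, and the set is empty for negative `k`. -/
def IB (n : ℕ) (k : ℤ) : Set (B n) := {π | (invB π : ℤ) = k}

/-- `𝒞_B(n)`: the elements of `I_B(n, n - 1)` each of whose prefixes of length `k ≥ 1` has fewer
than `k` inversions of type `B`. -/
def CB (n : ℕ) : Set (B n) :=
  {π | π ∈ IB n ((n : ℤ) - 1) ∧ ∀ (k : ℕ) (hk : k ≤ n), 1 ≤ k → invWord (pre π k hk) < k}

instance (n : ℕ) : Finite (SignedIndex n) :=
  Set.Finite.to_subtype <| (Set.finite_Icc (-(n : ℤ)) n).subset fun _ hz => abs_le.mp hz.2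

/-- The Mahonian number of type `B`, `i_B(n, k) = |I_B(n, k)|`, the cardinality of a finite set. -/
noncomputable def iB (n : ℕ) (k : ℤ) : ℕ := (IB n k).ncard

/-- The subdiagonal generating function `T_j(x) = ∑_{n ≥ 0} i_B(n, n - j) x ^ n`. -/
noncomputable def T (j : ℕ) : ℕ⟦X⟧ := PowerSeries.mk fun n => iB n ((n : ℤ) - j)

end MahonianB

namespace MahonianB

/-! The contributions `e p` of the positions form the `code` of a signed permutation, and coding is
a bijection from `B n` onto all sequences with `e p ≤ 2 * p + 1` for `p < n`. Everything thereby
becomes a statement about partial sums. Call `k` minus the sum of the first `k` terms the excess at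
`k`: it starts at 0 and rises by at most one per step. A sequence ending with excess `j + 1` is cut
at the last index of excess `j`. What follows keeps positive relative excess and ends with relative
excess 1, so it codes an element of `CB`; there the code bound is automatic, which makes gluing
unrestricted (`lastPassageEquiv`). The same cut applied to subdiagonal sequences gives the Catalan
recurrence, and read as a convolution it gives the recursion for `T`. -/

/-! ### Last-passage decomposition of sequences -/

/-- Sequences `e` supported on `{0, …, n - 1}` with total sum `n - d` such that `Q` holds of every
index `p < n`, the term `e p` and the partial sum `e 0 + ⋯ + e p`. The number `d` is the excess. -/
def SumSeq (Q : ℕ → ℕ → ℕ → Prop) (n d : ℕ) : Set (ℕ → ℕ) :=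
  {e | (∀ p, n ≤ p → e p = 0) ∧ (∀ p < n, Q p (e p) (∑ q ∈ Finset.range (p + 1), e q)) ∧
    ∑ q ∈ Finset.range n, e q + d = n}

/-- The bound on the code of a signed permutation. -/
def CodeBound (p x _s : ℕ) : Prop := x ≤ 2 * p + 1

/-- The partial sum of the first `p + 1` terms is smaller than `p + 1`. -/
def Subdiagonal (p _x s : ℕ) : Prop := s ≤ p

/-- Concatenation of the first `i` terms of `a` with `b`. -/
def concat (i : ℕ) (a b : ℕ → ℕ) (p : ℕ) : ℕ := if p < i then a p else b (p - i)

lemma sum_concat_of_le {i k : ℕ} (a b : ℕ → ℕ) (h : k ≤ i) :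
    ∑ q ∈ Finset.range k, concat i a b q = ∑ q ∈ Finset.range k, a q :=
  Finset.sum_congr rfl fun _ hq => if_pos ((Finset.mem_range.mp hq).trans_le h)

lemma sum_concat_add (i k : ℕ) (a b : ℕ → ℕ) :
    ∑ q ∈ Finset.range (i + k), concat i a b q =
      ∑ q ∈ Finset.range i, a q + ∑ q ∈ Finset.range k, b q := by
  rw [Finset.sum_range_add, sum_concat_of_le a b le_rfl]
  congr 1
  refine Finset.sum_congr rfl fun q _ => ?_
  simp [concat]

/-- Past the cut the total is at most the index, and a term is at most the partial sum containing
it, so `hQ` supplies `Q` there. -/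
lemma concat_mem {Q : ℕ → ℕ → ℕ → Prop} (hQ : ∀ p x s, x ≤ s → s ≤ p → Q p x s)
    {n i j : ℕ} (hi : i ≤ n) {a b : ℕ → ℕ} (ha : a ∈ SumSeq Q i j)
    (hb : b ∈ SumSeq Subdiagonal (n - i) 1) : concat i a b ∈ SumSeq Q n (j + 1) := by
  obtain ⟨_, ha1, ha2⟩ := ha
  obtain ⟨hb0, hb1, hb2⟩ := hb
  obtain ⟨m, rfl⟩ := Nat.exists_eq_add_of_le hi
  rw [Nat.add_sub_cancel_left] at hb0 hb1 hb2
  refine ⟨fun p hp => ?_, fun p hp => ?_, ?_⟩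
  · rw [concat, if_neg (by omega)]
    exact hb0 _ (by omega)
  · by_cases h : p < i
    · rw [sum_concat_of_le a b h, concat, if_pos h]
      exact ha1 p h
    · obtain ⟨k, rfl⟩ := Nat.exists_eq_add_of_le (not_lt.mp h)
      apply hQ
      · exact Finset.single_le_sum (f := concat i a b) (fun _ _ => Nat.zero_le _)
          (Finset.self_mem_range_succ _)
      · have := hb1 k (by omega)
        rw [add_assoc, sum_concat_add]
        simp only [Subdiagonal] at this
        omega
  · rw [sum_concat_add]
    omega

/-- In a concatenation of a sequence of excess `j` with a subdiagonal one, the length of the first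
part is the last index at which the excess is at most `j`. -/
lemma lt_sum_concat {Q : ℕ → ℕ → ℕ → Prop} {n i j k : ℕ} {a b : ℕ → ℕ}
    (ha : a ∈ SumSeq Q i j) (hb : b ∈ SumSeq Subdiagonal (n - i) 1) (hik : i < k) (hk : k ≤ n) :
    ∑ q ∈ Finset.range k, concat i a b q + j < k := by
  obtain ⟨m, rfl⟩ := Nat.exists_eq_add_of_lt hik
  have h1 := hb.2.1 m (by omega)
  have h2 := ha.2.2
  rw [add_assoc, sum_concat_add]
  simp only [Subdiagonal] at h1
  omega

/-- The excess at `i'` is exactly `j`, but beyond `i` it exceeds `j`. Used both ways, this recovers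
the cut from the concatenation. -/
lemma concat_index_le {Q : ℕ → ℕ → ℕ → Prop} {n i i' j : ℕ} {a b a' b' : ℕ → ℕ} (hi' : i' ≤ n)
    (ha : a ∈ SumSeq Q i j) (hb : b ∈ SumSeq Subdiagonal (n - i) 1)
    (ha' : a' ∈ SumSeq Q i' j) (h : concat i a b = concat i' a' b') : i' ≤ i := by
  by_contra hlt
  have h1 := lt_sum_concat ha hb (not_le.mp hlt) hi'
  rw [h, sum_concat_of_le a' b' le_rfl] at h1
  have := ha'.2.2
  omega

lemma exists_concat {Q : ℕ → ℕ → ℕ → Prop} {n j : ℕ} {e : ℕ → ℕ} (he : e ∈ SumSeq Q n (j + 1)) :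
    ∃ i ≤ n, ∃ a ∈ SumSeq Q i j, ∃ b ∈ SumSeq Subdiagonal (n - i) 1, concat i a b = e := by
  obtain ⟨he0, he1, he2⟩ := he
  let P : ℕ → Prop := fun k => k ≤ ∑ q ∈ Finset.range k, e q + j
  classical
  set i := Nat.findGreatest P n with hidef
  have hin : i ≤ n := Nat.findGreatest_le n
  have hPi : P i := Nat.findGreatest_spec (P := P) (Nat.zero_le n) (Nat.zero_le _)
  have hlt : ∀ k, i < k → k ≤ n → ∑ q ∈ Finset.range k, e q + j < k := fun k hk hkn =>
    not_le.mp (Nat.findGreatest_is_greatest (P := P) hk hkn)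
  have hin' : i < n := by
    rcases hin.lt_or_eq with h | h
    · exact h
    · simp only [P, h] at hPi
      omega
  -- The excess is at most `j` at `i` and more than `j` at `i + 1`; a step raises it by at most one,
  -- so it equals `j` at `i`.
  have hi : ∑ q ∈ Finset.range i, e q + j = i := by
    have := hlt (i + 1) (by omega) (by omega)
    rw [Finset.sum_range_succ] at this
    simp only [P] at hPi
    omega
  refine ⟨i, hin, fun p => if p < i then e p else 0, ⟨fun p hp => if_neg (by omega), ?_, ?_⟩,
    fun p => e (i + p), ⟨fun p hp => he0 _ (by omega), fun p hp => ?_, ?_⟩, ?_⟩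
  · intro p hp
    have : ∑ q ∈ Finset.range (p + 1), (if q < i then e q else 0)
        = ∑ q ∈ Finset.range (p + 1), e q :=
      Finset.sum_congr rfl fun q hq => if_pos (by have := Finset.mem_range.mp hq; omega)
    rw [this]
    simpa [hp] using he1 p (by omega)
  · rw [Finset.sum_congr rfl fun _ hq => if_pos (Finset.mem_range.mp hq)]
    exact hi
  · have h1 := hlt (i + (p + 1)) (by omega) (by omega)
    rw [Finset.sum_range_add] at h1
    simp only [Subdiagonal]
    omega
  · have : i + (n - i) = n := by omega
    rw [← this, Finset.sum_range_add] at he2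
    dsimp only
    omega
  · ext p
    by_cases h : p < i
    · simp [concat, h]
    · simp [concat, h, Nat.add_sub_cancel' (not_lt.mp h)]

/-- Decomposition of a sequence at the last index where its excess is `j`. -/
noncomputable def lastPassageEquiv {Q : ℕ → ℕ → ℕ → Prop} (hQ : ∀ p x s, x ≤ s → s ≤ p → Q p x s)
    (n j : ℕ) : (Σ i : Fin (n + 1), SumSeq Q i j × SumSeq Subdiagonal (n - (i : ℕ)) 1) ≃
      SumSeq Q n (j + 1) :=
  Equiv.ofBijective
    (fun x => ⟨concat x.1 x.2.1 x.2.2, concat_mem hQ (by omega) x.2.1.2 x.2.2.2⟩) <| by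
    constructor
    · rintro ⟨i, ⟨a, ha⟩, ⟨b, hb⟩⟩ ⟨i', ⟨a', ha'⟩, ⟨b', hb'⟩⟩ h
      have h : concat i a b = concat i' a' b' := congrArg Subtype.val h
      obtain rfl : i = i' := Fin.ext <| le_antisymm
        (concat_index_le (by omega) ha' hb' ha h.symm)
        (concat_index_le (by omega) ha hb ha' h)
      have h1 : a = a' := by
        ext p
        by_cases hp : p < i
        · simpa [concat, hp] using congrFun h p
        · rw [ha.1 p (by omega), ha'.1 p (by omega)]
      have h2 : b = b' := by
        ext p
        simpa [concat] using congrFun h (i + p)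
      subst h1 h2
      rfl
    · rintro ⟨e, he⟩
      obtain ⟨i, hi, a, ha, b, hb, rfl⟩ := exists_concat he
      exact ⟨⟨⟨i, by omega⟩, ⟨a, ha⟩, ⟨b, hb⟩⟩, rfl⟩

/-! ### Catalan count of subdiagonal sequences -/

lemma sumSeq_subdiagonal_zero : SumSeq Subdiagonal 0 1 = ∅ := by
  ext e
  simp [SumSeq]

lemma sumSeq_subdiagonal_one : SumSeq Subdiagonal 1 1 = {0} := by
  ext e
  simp only [SumSeq, Subdiagonal, Set.mem_ofPred_eq, Set.mem_singleton_iff]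
  constructor
  · rintro ⟨h0, -, h1⟩
    ext p
    rcases Nat.eq_zero_or_pos p with rfl | hp
    · simpa using h1
    · exact h0 p hp
  · rintro rfl
    simp

lemma sum_update_self_range_succ (e : ℕ → ℕ) (n x : ℕ) :
    ∑ q ∈ Finset.range (n + 1), Function.update e n x q = ∑ q ∈ Finset.range n, e q + x := by
  rw [Finset.sum_range_succ, Function.update_self]
  congr 1
  exact Finset.sum_congr rfl fun q hq =>
    Function.update_of_ne (Finset.mem_range.mp hq).ne _ _

/-- At the last index subdiagonality follows from the excess being positive, so only earlier indices
need checking. -/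
lemma update_mem_sumSeq {n d x : ℕ} {e : ℕ → ℕ} (he0 : ∀ p, n + 1 ≤ p → e p = 0)
    (he1 : ∀ p < n, ∑ q ∈ Finset.range (p + 1), e q ≤ p)
    (hx : ∑ q ∈ Finset.range n, e q + x + (d + 1) = n + 1) :
    Function.update e n x ∈ SumSeq Subdiagonal (n + 1) (d + 1) := by
  refine ⟨fun p hp => ?_, fun p hp => ?_, ?_⟩
  · rw [Function.update_of_ne (by omega), he0 p hp]
  · simp only [Subdiagonal]
    rcases Nat.lt_succ_iff_lt_or_eq.mp hp with h | rfl
    · refine (Finset.sum_congr rfl fun q hq => ?_ :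
        _ = ∑ q ∈ Finset.range (p + 1), e q).trans_le (he1 p h)
      have := Finset.mem_range.mp hq
      exact Function.update_of_ne (by omega) _ _
    · rw [sum_update_self_range_succ]
      omega
  · rw [sum_update_self_range_succ]
    exact hx

/-- Lowering the last term of a subdiagonal sequence by one. -/
def lowerLastEquiv (m : ℕ) :
    SumSeq Subdiagonal (m + 2) 1 ≃ SumSeq Subdiagonal (m + 2) 2 where
  toFun e := ⟨Function.update e.1 (m + 1) (e.1 (m + 1) - 1), by
    obtain ⟨e, h0, h1, h2⟩ := e
    refine update_mem_sumSeq (d := 1) h0 (fun p hp => h1 p (by omega)) ?_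
    -- The first `m + 1` terms sum to at most `m` and the total is `m + 1`, so the last term is
    -- positive and the subtraction is not truncated.
    have := h1 m (by omega)
    simp only [Subdiagonal] at this
    rw [Finset.sum_range_succ] at h2
    dsimp only
    omega⟩
  invFun e := ⟨Function.update e.1 (m + 1) (e.1 (m + 1) + 1), by
    obtain ⟨e, h0, h1, h2⟩ := e
    refine update_mem_sumSeq (d := 0) h0 (fun p hp => h1 p (by omega)) ?_
    rw [Finset.sum_range_succ] at h2
    dsimp only
    omega⟩
  left_inv e := by
    obtain ⟨e, h0, h1, h2⟩ := e
    have := h1 m (by omega)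
    simp only [Subdiagonal] at this
    rw [Finset.sum_range_succ] at h2
    apply Subtype.ext
    simp only [Function.update_self, Function.update_idem]
    rw [Nat.sub_add_cancel (by omega), Function.update_eq_self]
  right_inv e := by
    apply Subtype.ext
    simp

lemma finite_sumSeq_subdiagonal (n : ℕ) : (SumSeq Subdiagonal n 1).Finite := by
  refine Set.Finite.of_finite_image (f := fun e (p : Fin n) => e p)
    ((Set.finite_Iic (fun _ : Fin n => n)).subset ?_) ?_
  · rintro _ ⟨e, he, rfl⟩ p
    have h1 := he.2.1 p p.2
    have h2 := Finset.single_le_sum (f := e) (fun _ _ => Nat.zero_le _)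
      (Finset.self_mem_range_succ (p : ℕ))
    simp only [Subdiagonal] at h1
    have := p.2
    dsimp only
    omega
  · intro e he e' he' h
    ext p
    by_cases hp : p < n
    · exact congrFun h ⟨p, hp⟩
    · rw [he.1 p (by omega), he'.1 p (by omega)]

/-- Lowering the last term makes the excess 2, and the last-passage cut then yields two subdiagonal
sequences of excess 1. Neither can be empty, which leaves the Catalan convolution. -/
lemma card_sumSeq_subdiagonal (m : ℕ) :
    Nat.card (SumSeq Subdiagonal (m + 1) 1) = catalan m := by
  induction m using Nat.strong_induction_on with
  | _ m ih =>
    rcases m with _ | m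
    · rw [sumSeq_subdiagonal_one]
      simp
    · have := fun n => (finite_sumSeq_subdiagonal n).to_subtype
      rw [Nat.card_congr ((lowerLastEquiv m).trans
        (lastPassageEquiv (Q := Subdiagonal) (fun p x s _ h => h) (m + 2) 1).symm),
        Nat.card_sigma, Fin.sum_univ_succ, Fin.sum_univ_castSucc, catalan_succ]
      simp only [Nat.card_prod]
      have h0 : Nat.card (SumSeq Subdiagonal 0 1) = 0 := by
        rw [sumSeq_subdiagonal_zero]
        simp
      simp only [Fin.val_zero, h0, zero_mul, zero_add, Fin.val_succ, Fin.val_castSucc,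
        Fin.val_last, Nat.sub_self, mul_zero, add_zero]
      refine Finset.sum_congr rfl fun i _ => ?_
      rw [ih i (by omega), show m + 2 - (i + 1) = (m - i) + 1 by omega, ih (m - i) (by omega)]

/-! ### Injectivity of the code -/

lemma oneLine_ne_zero {n : ℕ} (π : B n) (p : Fin n) : oneLine π p ≠ 0 :=
  (π.1 _).2.1

lemma abs_oneLine_mem {n : ℕ} (π : B n) (p : Fin n) : |oneLine π p| ∈ Finset.Icc (1 : ℤ) n :=
  Finset.mem_Icc.mpr ⟨Int.one_le_abs (π.1 _).2.1, (π.1 _).2.2⟩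

lemma abs_oneLine_injective {n : ℕ} (π : B n) : Function.Injective fun p => |oneLine π p| := by
  intro p q h
  rcases abs_eq_abs.mp h with h | h
  · have := congrArg Subtype.val (π.1.injective (Subtype.ext h))
    simp only [add_left_inj, Nat.cast_inj] at this
    exact Fin.ext this
  · exfalso
    have h' := congrArg Subtype.val (π.1.injective (Subtype.ext (h.trans
      (congrArg Subtype.val (π.2 _)).symm)))
    change ((p : ℕ) : ℤ) + 1 = -(((q : ℕ) : ℤ) + 1) at h'
    omega

lemma oneLine_injective (n : ℕ) : Function.Injective (oneLine (n := n)) := by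
  intro π ρ h
  have key : ∀ z : SignedIndex n, 0 < z.1 → π.1 z = ρ.1 z := by
    rintro ⟨z, hz⟩ hpos
    obtain ⟨p, hp⟩ : ∃ p : Fin n, z = (p : ℤ) + 1 := by
      have := (abs_le.mp hz.2).2
      dsimp only at hpos
      exact ⟨⟨(z - 1).toNat, by omega⟩, by simp; omega⟩
    subst hp
    exact Subtype.ext (congrFun h p)
  apply Subtype.ext
  ext1 z
  rcases lt_or_gt_of_ne z.2.1 with hz | hz
  · have h1 := key (-z) (neg_pos.mpr hz)
    rw [π.2, ρ.2] at h1
    have h2 := congrArg Subtype.val h1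
    exact Subtype.ext (neg_injective h2)
  · exact key z hz

/-- The code of a signed permutation: the contributions of the positions to `invB`. -/
def code {n : ℕ} (π : B n) (p : ℕ) : ℕ := if h : p < n then invAt (oneLine π) ⟨p, h⟩ else 0

/-- The number of letters to the left of position `p` that are larger in absolute value. -/
def largerBefore {n : ℕ} (w : Fin n → ℤ) (p : Fin n) : ℕ :=
  (Finset.univ.filter fun q : Fin n => q < p ∧ |w p| < |w q|).card

lemma smaller_add_largerBefore {n : ℕ} {w : Fin n → ℤ} (hw : Function.Injective fun p => |w p|)
    (p : Fin n) :
    (Finset.univ.filter fun q : Fin n => q < p ∧ |w q| < |w p|).card + largerBefore w p = p := by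
  rw [largerBefore, ← Finset.card_union_of_disjoint, ← Fin.card_Iio p]
  · congr 1
    ext q
    simp only [Finset.mem_union, Finset.mem_filter, Finset.mem_univ, true_and, Finset.mem_Iio]
    rw [← and_or_left, and_iff_left_iff_imp]
    exact fun h => lt_or_gt_of_ne (hw.ne h.ne)
  · rw [Finset.disjoint_filter]
    rintro q - ⟨-, h⟩ ⟨-, h'⟩
    exact lt_asymm h h'

lemma largerBefore_le {n : ℕ} {w : Fin n → ℤ} (hw : Function.Injective fun p => |w p|)
    (p : Fin n) : largerBefore w p ≤ p :=
  (smaller_add_largerBefore hw p).symm ▸ Nat.le_add_left _ _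

/-- Smaller and larger earlier letters together number `p`. Positive letters thus give values in
`[0, p]` and negative ones in `[p + 1, 2 * p + 1]`, so the value determines both the sign and
`largerBefore`. -/
lemma invAt_eq {n : ℕ} {w : Fin n → ℤ} (hw : Function.Injective fun p => |w p|) (p : Fin n) :
    invAt w p = if 0 < w p then largerBefore w p else 2 * p + 1 - largerBefore w p := by
  have := smaller_add_largerBefore hw p
  unfold invAt
  split_ifs
  · rfl
  · rw [← largerBefore]
    omega

lemma image_abs_oneLine {n : ℕ} (π : B n) :
    Finset.univ.image (fun p => |oneLine π p|) = Finset.Icc (1 : ℤ) n := by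
  apply Finset.eq_of_subset_of_card_le
  · intro z hz
    obtain ⟨p, -, rfl⟩ := Finset.mem_image.mp hz
    exact abs_oneLine_mem π p
  · rw [Finset.card_image_of_injective _ (abs_oneLine_injective π)]
    simp

/-- The absolute values of the letters up to position `p` are determined by the later ones. -/
lemma image_abs_Iic {n : ℕ} (π : B n) (p : Fin n) :
    (Finset.Iic p).image (fun p => |oneLine π p|) =
      Finset.Icc (1 : ℤ) n \ (Finset.Ioi p).image (fun p => |oneLine π p|) := by
  rw [← image_abs_oneLine π, ← Finset.image_sdiff _ _ (abs_oneLine_injective π)]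
  congr 1
  ext q
  simp

lemma largerBefore_eq_card {n : ℕ} (π : B n) (p : Fin n) :
    largerBefore (oneLine π) p = (((Finset.Iic p).image fun p => |oneLine π p|).filter
      fun z => |oneLine π p| < z).card := by
  rw [Finset.filter_image, Finset.card_image_of_injective _ (abs_oneLine_injective π),
    largerBefore]
  congr 1
  ext q
  simp only [Finset.mem_filter, Finset.mem_univ, true_and, Finset.mem_Iic]
  refine and_congr_left fun h => ⟨le_of_lt, fun h' => lt_of_le_of_ne h' ?_⟩
  rintro rfl
  exact lt_irrefl _ h

lemma eq_of_card_filter_lt_eq {A : Finset ℤ} {a b : ℤ} (ha : a ∈ A) (hb : b ∈ A)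
    (h : (A.filter (a < ·)).card = (A.filter (b < ·)).card) : a = b := by
  have key : ∀ {a b : ℤ}, b ∈ A → a < b →
      (A.filter (b < ·)).card < (A.filter (a < ·)).card := by
    intro a b hb hab
    apply Finset.card_lt_card
    rw [Finset.ssubset_iff_of_subset (Finset.monotone_filter_right A fun _ _ h => hab.trans h)]
    exact ⟨b, by simp [hb, hab]⟩
  rcases lt_trichotomy a b with hab | hab | hab
  · exact absurd h (key hb hab).ne'
  · exact hab
  · exact absurd h (key ha hab).ne

/-- The word is recovered from right to left: the later letters fix the set of absolute values still
available, `largerBefore` is a rank in that set, and the sign is read off the size of the code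
entry. -/
lemma code_injective (n : ℕ) : Function.Injective (code (n := n)) := by
  intro π ρ h
  have hinv : ∀ p, invAt (oneLine π) p = invAt (oneLine ρ) p := fun p => by
    simpa [code] using congrFun h p
  apply oneLine_injective
  have key : ∀ k (p : Fin n), n - p ≤ k → oneLine π p = oneLine ρ p := by
    intro k
    induction k with
    | zero => intro p hp; omega
    | succ k ih =>
      intro p hp
      have himg : (Finset.Iic p).image (fun p => |oneLine π p|) =
          (Finset.Iic p).image (fun p => |oneLine ρ p|) := by
        rw [image_abs_Iic, image_abs_Iic]
        congr 1
        refine Finset.image_congr fun q hq => ?_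
        have : p < q := by simpa using hq
        simp only [ih q (by omega)]
      have h1 := hinv p
      rw [invAt_eq (abs_oneLine_injective π), invAt_eq (abs_oneLine_injective ρ)] at h1
      have h2 := largerBefore_le (abs_oneLine_injective π) p
      have h3 := largerBefore_le (abs_oneLine_injective ρ) p
      have h4 : largerBefore (oneLine π) p = largerBefore (oneLine ρ) p := by
        split_ifs at h1 <;> omega
      have h5 : 0 < oneLine π p ↔ 0 < oneLine ρ p := by
        split_ifs at h1 <;> omega
      rw [largerBefore_eq_card, largerBefore_eq_card, ← himg] at h4
      have h6 := eq_of_card_filter_lt_eq (Finset.mem_image_of_mem _ (Finset.mem_Iic.mpr le_rfl))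
        (himg ▸ Finset.mem_image_of_mem _ (Finset.mem_Iic.mpr le_rfl)) h4
      rcases abs_eq_abs.mp h6 with h | h
      · exact h
      · have := oneLine_ne_zero π p
        omega
  exact funext fun p => key _ p le_rfl

lemma code_lt {n : ℕ} (π : B n) (p : Fin n) : code π p < 2 * p + 2 := by
  have h : code π p = invAt (oneLine π) p := dif_pos p.2
  rw [h, invAt_eq (abs_oneLine_injective π)]
  have := largerBefore_le (abs_oneLine_injective π) p
  split_ifs <;> omega

/-- The code as an element of a product of finite types. -/
def codeFin {n : ℕ} (π : B n) (p : Fin n) : Fin (2 * (p : ℕ) + 2) := ⟨code π p, code_lt π p⟩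

lemma codeFin_injective (n : ℕ) : Function.Injective (codeFin (n := n)) := by
  intro π ρ h
  apply code_injective
  ext p
  by_cases hp : p < n
  · exact congrArg Fin.val (congrFun h ⟨p, hp⟩)
  · simp [code, hp]

/-! ### Surjectivity of the code, by counting -/

/-- The letter with absolute value `p + 1` and sign given by `s`. -/
def letter (p : ℕ) (s : Bool) : ℤ := if s then (p : ℤ) + 1 else -((p : ℤ) + 1)

/-- A signed index is an absolute value together with a sign. -/
def signedIndexEquiv (n : ℕ) : Fin n × Bool ≃ SignedIndex n where
  toFun x := ⟨letter x.1 x.2, by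
    unfold letter; split_ifs <;> omega, by
    have := x.1.2
    rw [abs_le]; unfold letter; split_ifs <;> omega⟩
  invFun z := (⟨(|z.1| - 1).toNat, by
    have h1 := Int.one_le_abs z.2.1
    have h2 := z.2.2
    omega⟩, decide (0 < z.1))
  left_inv := by
    rintro ⟨p, s⟩
    cases s
    · have : |(-1 : ℤ) + -(p : ℤ)| = p + 1 := by rw [abs_of_neg] <;> omega
      ext <;> simp [letter, this]
    · have : |(p : ℤ) + 1| = p + 1 := abs_of_pos (by omega)
      ext <;> simp [letter, this]
  right_inv := by
    rintro ⟨z, hz⟩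
    apply Subtype.ext
    have h1 := Int.one_le_abs hz.1
    rcases lt_or_gt_of_ne hz.1 with h | h
    · simp only [letter, h.not_gt]
      rw [abs_of_neg h] at *
      simp
      omega
    · simp only [letter, h]
      rw [abs_of_pos h] at *
      simp
      omega

lemma neg_signedIndexEquiv {n : ℕ} (x : Fin n × Bool) :
    -signedIndexEquiv n x = signedIndexEquiv n (x.1, !x.2) := by
  obtain ⟨p, s⟩ := x
  apply Subtype.ext
  change -letter p s = letter p (!s)
  cases s <;> simp [letter]

/-- The signed permutation with given absolute values and signs. -/
def ofPermSigns {n : ℕ} (x : Equiv.Perm (Fin n) × (Fin n → Bool)) : B n :=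
  ⟨(signedIndexEquiv n).permCongr
    ((Equiv.prodShear x.1 fun p => if x.2 p then Equiv.refl Bool else Equiv.boolNot)), by
    intro j
    obtain ⟨⟨p, s⟩, rfl⟩ := (signedIndexEquiv n).surjective j
    rw [neg_signedIndexEquiv]
    simp only [Equiv.permCongr_apply, Equiv.symm_apply_apply, neg_signedIndexEquiv]
    congr 1
    cases h : x.2 p <;> simp [Equiv.prodShear, h]⟩

lemma ofPermSigns_injective (n : ℕ) : Function.Injective (ofPermSigns (n := n)) := by
  rintro ⟨σ, s⟩ ⟨τ, t⟩ h
  have h1 := (signedIndexEquiv n).permCongr.injective (congrArg Subtype.val h)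
  have h2 : ∀ p, σ p = τ p ∧ s p = t p := by
    intro p
    have := Equiv.congr_fun h1 (p, true)
    clear h1 h
    cases hs : s p <;> cases ht : t p <;> simp_all [Equiv.prodShear]
  exact Prod.ext (Equiv.ext fun p => (h2 p).1) (funext fun p => (h2 p).2)

lemma codeFin_bijective (n : ℕ) : Function.Bijective (codeFin (n := n)) := by
  refine (codeFin_injective n).bijective_of_nat_card_le ?_
  -- A lower bound on the size of `B n` suffices: permutations with signs inject into it, and their
  -- number `n! * 2 ^ n` is the product of the `2 * p + 2`.
  refine le_trans (le_of_eq ?_) (Nat.card_le_card_of_injective _ (ofPermSigns_injective n))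
  have : ∀ m : ℕ, ∏ p : Fin m, (2 * (p : ℕ) + 2) = m.factorial * 2 ^ m := by
    intro m
    induction m with
    | zero => simp
    | succ m ih =>
      rw [Fin.prod_univ_castSucc, Nat.factorial_succ, pow_succ]
      simp only [Fin.val_castSucc, ih, Fin.val_last]
      ring
  simp [Nat.card_eq_fintype_card, Fintype.card_perm, this]

/-- The codes are the sequences supported on `{0, …, n - 1}` with `e p ≤ 2 p + 1`. -/
lemma exists_code_eq {n : ℕ} {e : ℕ → ℕ} (h0 : ∀ p, n ≤ p → e p = 0)
    (h1 : ∀ p < n, e p ≤ 2 * p + 1) : ∃ π : B n, code π = e := by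
  obtain ⟨π, hπ⟩ := (codeFin_bijective n).2 fun p => ⟨e p, by have := h1 p p.2; omega⟩
  refine ⟨π, funext fun p => ?_⟩
  by_cases hp : p < n
  · exact congrArg Fin.val (congrFun hπ ⟨p, hp⟩)
  · rw [code, dif_neg hp, h0 p (by omega)]

/-! ### Transfer from signed permutations to codes -/

lemma code_of_le {n : ℕ} (π : B n) {p : ℕ} (hp : n ≤ p) : code π p = 0 :=
  dif_neg (by omega)

/-- The contribution of a position depends only on its letter and those to its left, so truncating
the word does not change it. -/
lemma invWord_pre {n : ℕ} (π : B n) (k : ℕ) (hk : k ≤ n) :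
    invWord (pre π k hk) = ∑ q ∈ Finset.range k, code π q := by
  rw [invWord, Finset.sum_range]
  refine Finset.sum_congr rfl fun p _ => ?_
  have hp : (p : ℕ) < n := p.2.trans_le hk
  have hcard : ∀ P : ℤ → Prop, ∀ [DecidablePred P],
      (Finset.univ.filter fun q : Fin k => q < p ∧ P (pre π k hk q)).card =
        (Finset.univ.filter fun q : Fin n => q < ⟨p, hp⟩ ∧ P (oneLine π q)).card := by
    intro P _
    rw [← Finset.card_map (Fin.castLEEmb hk)]
    congr 1
    ext q
    simp only [Finset.mem_map, Finset.mem_filter, Finset.mem_univ, true_and]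
    constructor
    · rintro ⟨r, hr, rfl⟩
      exact hr
    · intro hq
      exact ⟨⟨q, lt_trans (Fin.lt_def.mp hq.1) p.2⟩, hq, rfl⟩
  rw [code, dif_pos hp, invAt, invAt, hcard fun z => |pre π k hk p| < |z|,
    hcard fun z => |z| < |pre π k hk p|]
  rfl

lemma invB_eq_sum_code {n : ℕ} (π : B n) : invB π = ∑ q ∈ Finset.range n, code π q :=
  invWord_pre π n le_rfl

lemma mem_IB_iff {n d : ℕ} (π : B n) :
    π ∈ IB n ((n : ℤ) - d) ↔ code π ∈ SumSeq CodeBound n d := by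
  have h : π ∈ IB n ((n : ℤ) - d) ↔ ((invB π : ℕ) : ℤ) = n - d := Iff.rfl
  rw [h, invB_eq_sum_code]
  constructor
  · intro h
    refine ⟨fun p => code_of_le π, fun p hp => ?_, by omega⟩
    have := code_lt π ⟨p, hp⟩
    simp only [CodeBound]
    dsimp only at this
    omega
  · rintro ⟨-, -, h⟩
    omega

lemma mem_CB_iff {n : ℕ} (π : B n) : π ∈ CB n ↔ code π ∈ SumSeq Subdiagonal n 1 := by
  have h : π ∈ CB n ↔ ((invB π : ℕ) : ℤ) = n - 1 ∧
    ∀ (k : ℕ) (hk : k ≤ n), 1 ≤ k → invWord (pre π k hk) < k := Iff.rfl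
  rw [h, invB_eq_sum_code]
  simp only [invWord_pre]
  constructor
  · rintro ⟨h1, h2⟩
    exact ⟨fun p => code_of_le π, fun p hp => Nat.lt_succ_iff.mp (h2 (p + 1) hp (by omega)),
      by omega⟩
  · rintro ⟨-, h1, h2⟩
    refine ⟨by omega, fun k hk hk1 => ?_⟩
    obtain ⟨p, rfl⟩ := Nat.exists_eq_add_of_le' hk1
    exact Nat.lt_succ_iff.mpr (h1 p hk)

/-- The code as an equivalence between sets described by the code. -/
noncomputable def codeEquiv {n : ℕ} {S : Set (B n)} {R : Set (ℕ → ℕ)}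
    (h : ∀ π, π ∈ S ↔ code π ∈ R) (hR : ∀ e ∈ R, ∃ π : B n, code π = e) : S ≃ R :=
  Equiv.ofBijective (fun π => ⟨code π.1, (h _).mp π.2⟩) <| by
    constructor
    · intro π ρ hπ
      exact Subtype.ext (code_injective n (congrArg Subtype.val hπ))
    · rintro ⟨e, he⟩
      obtain ⟨π, rfl⟩ := hR e he
      exact ⟨⟨π, (h _).mpr he⟩, rfl⟩

/-- Signed permutations with `n - d` inversions correspond to their codes. -/
noncomputable def equivIB (n d : ℕ) : IB n ((n : ℤ) - d) ≃ SumSeq CodeBound n d :=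
  codeEquiv mem_IB_iff fun _ he => exists_code_eq he.1 he.2.1

/-- The codes of the elements of `CB n` are the subdiagonal sequences of excess `1`. -/
noncomputable def equivCB (n : ℕ) : CB n ≃ SumSeq Subdiagonal n 1 :=
  codeEquiv mem_CB_iff fun e he => exists_code_eq he.1 fun p hp => by
    have h1 := he.2.1 p hp
    have h2 := Finset.single_le_sum (f := e) (fun _ _ => Nat.zero_le _)
      (Finset.self_mem_range_succ p)
    simp only [Subdiagonal] at h1
    omega

/-- Signed permutations with `n - (j + 1)` inversions, cut at the last prefix, of some length `i`,
that has `i - j` inversions. -/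
noncomputable def decompEquiv (n j : ℕ) : IB n ((n : ℤ) - ((j + 1 : ℕ) : ℤ)) ≃
    Σ i : Fin (n + 1), IB (i : ℕ) (((i : ℕ) : ℤ) - (j : ℤ)) × CB (n - (i : ℕ)) :=
  (equivIB n (j + 1)).trans <|
    (lastPassageEquiv (Q := CodeBound) (fun p x s h1 h2 => by
      simp only [CodeBound]; omega) n j).symm.trans <|
    Equiv.sigmaCongrRight fun i => (Equiv.prodCongr (equivIB i j) (equivCB _)).symm

/-! ### Generating functions -/

lemma CB_zero : CB 0 = ∅ := by
  ext π
  rw [mem_CB_iff, sumSeq_subdiagonal_zero]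
  rfl

lemma ncard_CB_succ (m : ℕ) : (CB (m + 1)).ncard = catalan m := by
  rw [← Nat.card_coe_set_eq, Nat.card_congr (equivCB _), card_sumSeq_subdiagonal]

lemma X_mul_catalanSeries :
    (PowerSeries.X * PowerSeries.catalanSeries : ℕ⟦X⟧) = PowerSeries.mk fun n => (CB n).ncard := by
  ext n
  rcases n with _ | n
  · simp [CB_zero]
  · rw [PowerSeries.coeff_succ_X_mul, PowerSeries.catalanSeries_coeff, PowerSeries.coeff_mk,
      ncard_CB_succ]

lemma T_succ (j : ℕ) : T (j + 1) = PowerSeries.X * PowerSeries.catalanSeries * T j := by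
  -- The swap makes the first convolution index the length `i` of the `IB` factor, as in
  -- `decompEquiv`.
  rw [X_mul_catalanSeries, mul_comm]
  ext n
  rw [PowerSeries.coeff_mul, Finset.Nat.sum_antidiagonal_eq_sum_range_succ_mk, Finset.sum_range]
  simp only [T, PowerSeries.coeff_mk, iB]
  rw [← Nat.card_coe_set_eq, Nat.card_congr (decompEquiv n j), Nat.card_sigma]
  simp only [Nat.card_prod, Nat.card_coe_set_eq]

lemma T_eq_pow_mul (j : ℕ) : T j = (PowerSeries.X * PowerSeries.catalanSeries) ^ j * T 0 := by
  induction j with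
  | zero => simp
  | succ j ih => rw [T_succ, ih, pow_succ', ← mul_assoc]

end MahonianB

theorem theorem2p2 :
    -- the sets `𝒞_B(m)` are counted by Catalan numbers
    (MahonianB.CB 0 = ∅ ∧ ∀ m : ℕ, 1 ≤ m → (MahonianB.CB m).ncard = catalan (m - 1)) ∧
    -- the bijection
    (∀ j : ℕ, 1 ≤ j → ∀ n : ℕ,
      Nonempty (MahonianB.IB n ((n : ℤ) - (j : ℤ) - 1) ≃
        (Σ i : Fin (n + 1),
          MahonianB.IB (i : ℕ) (((i : ℕ) : ℤ) - (j : ℤ)) × MahonianB.CB (n - (i : ℕ))))) ∧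
    -- the recursion and the closed form for the generating functions
    (∀ j : ℕ, 1 ≤ j →
      MahonianB.T (j + 1) = PowerSeries.X * PowerSeries.catalanSeries * MahonianB.T j) ∧
    (∀ j : ℕ, 1 ≤ j →
      MahonianB.T j = (PowerSeries.X * PowerSeries.catalanSeries) ^ j * MahonianB.T 0) := by
  refine ⟨⟨MahonianB.CB_zero, fun m hm => ?_⟩, fun j _ n => ?_, fun j _ => MahonianB.T_succ j,
    fun j _ => MahonianB.T_eq_pow_mul j⟩
  · obtain ⟨m, rfl⟩ := Nat.exists_eq_add_of_le' hm
    exact MahonianB.ncard_CB_succ m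
  · have h : (n : ℤ) - j - 1 = n - ((j + 1 : ℕ) : ℤ) := by
      push_cast
      ring
    rw [h]
    exact ⟨MahonianB.decompEquiv n j⟩
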